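/- Let $R$ be an arbitrary associative ring with $1$; all modules are unital. For $r\in R$ let $\mathfrak r(r)=\{s\in R: rs=0\}$ be its right annihilator. The ring $R$ is \emph{right P-coherent} if every principal right ideal $rR$ is a finitely presented right $R$-module. A left $R$-module $M$ is \emph{torsion-free} if for all $r\in R$ and $m\in M$, $rm=0$ implies $m\in\mathfrak r(r)M$, where $\mathfrak r(r)M$ is the set of finite sums $\sum_i s_in_i$ with $s_i\in\mathfrak r(r)$, $n_i\in M$. A right $R$-module $M$ is \emph{divisible} if for all $r\in R$ and $m\in M$, $m\,\mathfrak r(r)=0$ implies $m\in Mr$. Let $\mathcal T\!f$ be the class of torsion-free left $R$-modules and $\mathcal Div$ the class of divisible right $R$-modules. For a right $R$-module $M$, its character module $M^*=\mathrm{Hom}_{\mathbb Z}(M,\mathbb Q/\mathbb Z)$ is a left $R$-module via $(rf)(m)=f(mr)$. A \emph{definable subcategory} is a full (isomorphism-closed) subcategory of the category of all left (or all right) $R$-modules that is closed under direct products, direct limits (of directed systems) and pure submodules. A (unary) \emph{pp formula} for left modules is a formula $\varphi(x)$ of the form $\exists y_1\dots y_n\ \bigwedge_{j=1}^k\bigl(a_jx+\sum_{i=1}^n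 b_{ji}y_i=0\bigr)$ with $a_j,b_{ji}\in R$; its elementary dual $\mathrm D\varphi(x)$ is the pp formula for right modules $\exists z_1\dots z_k\ \bigl(x+\sum_j z_ja_j=0\ \wedge\ \bigwedge_{i=1}^n\sum_j z_jb_{ji}=0\bigr)$; pp formulas for right modules and their duals (pp formulas for left modules) are defined symmetrically. A pp implication is a sentence $\forall x(\varphi\to\psi)$ with $\varphi,\psi$ pp formulas. For a class $\mathcal X$ of modules, $\mathrm D\mathcal X$ denotes the class of modules on the other side that satisfy $\forall x(\mathrm D\psi\to\mathrm D\varphi)$ for all pp formulas $\varphi,\psi$ such that $\forall x(\varphi\to\psi)$ is true in every member of $\mathcal X$. \textbf{Theorem.} (1) For every ring $R$ the following are equivalent: (i) $R$ is right P-coherent; (ii) the class $\mathcal T\!f$ is closed under direct products; (iii) the class $\mathcal Div$ is closed under direct limits; (iv) for every right $R$-module $M$, $M$ is divisible if and only if the left $R$-module $M^*$ is torsion-free; (v) $\mathcal T\!f$ is a definable subcategory; (v$'$) $\mathcal T\!f$ is axiomatized by a set of pp implications; (vi) $\mathcal Div$ is a definable subcategory; (vi$'$) $\mathcal Div$ is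 axiomatized by a set of pp implications. (2) If these conditions hold, then $\mathcal Div$ and $\mathcal T\!f$ are elementarily dual, i.e. $\mathrm D\,\mathcal Div=\mathcal T\!f$ and $\mathrm D\,\mathcal T\!f=\mathcal Div$. -/

import Mathlib

/-!
Right `R`-modules are modules over `Rᵐᵒᵖ`: the product `m · r` is `MulOpposite.op r • m`.
Classes of modules (full subcategories) are object properties of the category of modules.
-/

universe u v w

open CategoryTheory

namespace RDMod

section Basic

variable (R : Type u) [Ring R]

/-- A ring is right P-coherent if every principal right ideal `rR` is a finitely presented
right module. -/
def IsRightPCoherent : Prop :=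
  ∀ r : R, Module.FinitePresentation Rᵐᵒᵖ (Submodule.span Rᵐᵒᵖ ({r} : Set R))

/-- A left module `M` is torsion-free if `r m = 0` implies `m ∈ 𝔯(r) M`, where `𝔯(r)` is the
right annihilator of `r` in `R` and `𝔯(r) M` is the additive group of all finite sums of
products `s n` with `s ∈ 𝔯(r)` and `n ∈ M`. -/
def IsTorsionFree (M : Type w) [AddCommGroup M] [Module R M] : Prop :=
  ∀ (r : R) (m : M), r • m = 0 →
    m ∈ AddSubgroup.closure {x : M | ∃ (s : R) (n : M), r * s = 0 ∧ x = s • n}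

/-- A right module `M` is divisible if `m 𝔯(r) = 0` implies `m ∈ M r`, where `𝔯(r)` is the
right annihilator of `r` in `R`. -/
def IsDivisible (M : Type w) [AddCommGroup M] [Module Rᵐᵒᵖ M] : Prop :=
  ∀ (r : R) (m : M), (∀ s : R, r * s = 0 → MulOpposite.op s • m = 0) →
    ∃ n : M, m = MulOpposite.op r • n

/-- The class `𝒯f` of torsion-free left `R`-modules. -/
def Tf : ObjectProperty (ModuleCat.{w} R) := fun M => IsTorsionFree R M

/-- The class `𝒟iv` of divisible right `R`-modules. -/
def Div : ObjectProperty (ModuleCat.{w} Rᵐᵒᵖ) := fun M => IsDivisible R M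

/-- The left `R`-module structure on `Hom_ℤ(M, ℚ/ℤ)` for a right `R`-module `M`, given by
`(r f)(m) = f(m r)`. -/
@[reducible] def characterModuleStructure (M : Type w) [AddCommGroup M] [Module Rᵐᵒᵖ M] :
    Module R (CharacterModule M) where
  smul r f := AddMonoidHom.comp f (DistribSMul.toAddMonoidHom M (MulOpposite.op r))
  one_smul f := CharacterModule.ext M fun m => by
    change f (MulOpposite.op (1 : R) • m) = f m
    simp
  mul_smul r s f := CharacterModule.ext M fun m => by
    change f (MulOpposite.op (r * s) • m) = f (MulOpposite.op s • MulOpposite.op r • m)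
    rw [MulOpposite.op_mul, mul_smul]
  smul_zero _ := rfl
  smul_add _ _ _ := rfl
  add_smul r s f := CharacterModule.ext M fun m => by
    change f (MulOpposite.op (r + s) • m) =
      f (MulOpposite.op r • m) + f (MulOpposite.op s • m)
    rw [MulOpposite.op_add, add_smul, map_add]
  zero_smul f := CharacterModule.ext M fun m => by
    change f (MulOpposite.op (0 : R) • m) = 0
    simp

/-- The character module `M* = Hom_ℤ(M, ℚ/ℤ)` of a right `R`-module, a left `R`-module. -/
def characterModule (M : ModuleCat.{w} Rᵐᵒᵖ) : ModuleCat.{w} R :=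
  letI := characterModuleStructure R M
  ModuleCat.of R (CharacterModule M)

end Basic

section Definable

variable {R : Type u} [Ring R]

/-- The submodule `N` is pure in `M`: every finite system of linear equations with
constants in `N` that is solvable in `M` is solvable in `N`. -/
def IsPure {M : Type w} [AddCommGroup M] [Module R M] (N : Submodule R M) : Prop :=
  ∀ (k n : ℕ) (A : Matrix (Fin k) (Fin n) R) (c : Fin k → N),
    (∃ y : Fin n → M, ∀ j, ∑ i, A j i • y i = (c j : M)) →
      ∃ y : Fin n → N, ∀ j, ∑ i, A j i • y i = c j

/-- Closure under arbitrary direct products. -/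
def ClosedUnderProducts (𝒳 : ObjectProperty (ModuleCat.{w} R)) : Prop :=
  ∀ (ι : Type w) (M : ι → ModuleCat.{w} R),
    (∀ i, 𝒳 (M i)) → 𝒳 (ModuleCat.of R (∀ i, M i))

/-- Closure under direct limits of directed systems. -/
def ClosedUnderDirectLimits (𝒳 : ObjectProperty (ModuleCat.{w} R)) : Prop :=
  ∀ (ι : Type w) [Preorder ι] [IsDirectedOrder ι] [Nonempty ι] [DecidableEq ι]
    (M : ι → ModuleCat.{w} R) (f : ∀ i j, i ≤ j → M i →ₗ[R] M j)
    [DirectedSystem (fun i => M i) (fun i j h => f i j h)],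
    (∀ i, 𝒳 (M i)) → 𝒳 (ModuleCat.of R (Module.DirectLimit (fun i => M i) f))

/-- Closure under pure submodules. -/
def ClosedUnderPureSubmodules (𝒳 : ObjectProperty (ModuleCat.{w} R)) : Prop :=
  ∀ (M : ModuleCat.{w} R) (N : Submodule R M), IsPure N → 𝒳 M → 𝒳 (ModuleCat.of R N)

/-- A definable subcategory: a full subcategory of the category of all modules (closed
under isomorphism) that is closed under direct products, direct limits and pure
submodules. -/
structure IsDefinable (𝒳 : ObjectProperty (ModuleCat.{w} R)) : Prop where
  iso : 𝒳.IsClosedUnderIsomorphisms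
  products : ClosedUnderProducts 𝒳
  directLimits : ClosedUnderDirectLimits 𝒳
  pureSubmodules : ClosedUnderPureSubmodules 𝒳

end Definable

/-- A unary pp formula `φ(x)`, namely
`∃ y₀ … yₙ₋₁, ⋀_{j < k} (a j) x + ∑_{i < n} (B j i) yᵢ = 0`,
for left modules over `R`. Those for right modules are the ones over `Rᵐᵒᵖ`. -/
structure PPFormula (R : Type u) where
  /-- number of quantified variables -/
  n : ℕ
  /-- number of equations -/
  k : ℕ
  /-- coefficients of the free variable -/
  a : Fin k → R
  /-- coefficients of the quantified variables -/
  B : Matrix (Fin k) (Fin n) R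

namespace PPFormula

variable {R : Type u} [Ring R]

/-- The element `x` satisfies the formula `φ` in the module `M`, i.e. `x ∈ φ(M)`. -/
def Sat (φ : PPFormula R) {M : Type w} [AddCommGroup M] [Module R M] (x : M) : Prop :=
  ∃ y : Fin φ.n → M, ∀ j, φ.a j • x + ∑ i, φ.B j i • y i = 0

/-- The pp implication `∀ x (φ → ψ)` is true in the module `M`. -/
def ImpliesIn (φ ψ : PPFormula R) (M : Type w) [AddCommGroup M] [Module R M] : Prop :=
  ∀ x : M, φ.Sat x → ψ.Sat x

/-- `φ ≤_𝒳 ψ`: the implication `∀ x (φ → ψ)` is true in every member of `𝒳`. -/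
def LeOn (𝒳 : ObjectProperty (ModuleCat.{w} R)) (φ ψ : PPFormula R) : Prop :=
  ∀ M : ModuleCat.{w} R, 𝒳 M → φ.ImpliesIn ψ M

/-- The elementary dual of a pp formula for left modules, a formula for right modules: the
dual of `∃ y, ⋀_j (a j) x + ∑_i (B j i) yᵢ = 0` is
`∃ z, x + ∑_j zⱼ (a j) = 0 ∧ ⋀_i ∑_j zⱼ (B j i) = 0`. -/
def dual (φ : PPFormula R) : PPFormula Rᵐᵒᵖ where
  n := φ.k
  k := φ.n + 1
  a := Fin.cons 1 (fun _ => 0)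
  B := Fin.cons (fun j => MulOpposite.op (φ.a j)) (fun i j => MulOpposite.op (φ.B j i))

/-- The elementary dual of a pp formula for right modules, a formula for left modules: the
dual of `∃ y, ⋀_j x (a j) + ∑_i yᵢ (B j i) = 0` is
`∃ z, x + ∑_j (a j) zⱼ = 0 ∧ ⋀_i ∑_j (B j i) zⱼ = 0`. -/
def dualOfRight (φ : PPFormula Rᵐᵒᵖ) : PPFormula R where
  n := φ.k
  k := φ.n + 1
  a := Fin.cons 1 (fun _ => 0)
  B := Fin.cons (fun j => MulOpposite.unop (φ.a j)) (fun i j => MulOpposite.unop (φ.B j i))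

end PPFormula

section Duality

variable {R : Type u} [Ring R]

/-- The class `𝒳` is the class of models of a set of implications of pp formulas. -/
def IsPPAxiomatizable (𝒳 : ObjectProperty (ModuleCat.{w} R)) : Prop :=
  ∃ S : Set (PPFormula R × PPFormula R),
    ∀ M : ModuleCat.{w} R, 𝒳 M ↔ ∀ σ ∈ S, σ.1.ImpliesIn σ.2 M

/-- The elementary dual of a class of left modules: the class of right modules axiomatized
by the implications `∀ x (Dψ → Dφ)` for all `φ`, `ψ` with `φ ≤_𝒳 ψ`. -/
def dualClass (𝒳 : ObjectProperty (ModuleCat.{w} R)) :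
    ObjectProperty (ModuleCat.{w} Rᵐᵒᵖ) :=
  fun M => ∀ φ ψ : PPFormula R, PPFormula.LeOn 𝒳 φ ψ → ψ.dual.ImpliesIn φ.dual M

/-- The elementary dual of a class of right modules: the class of left modules axiomatized
by the implications `∀ x (Dψ → Dφ)` for all `φ`, `ψ` with `φ ≤_𝒳 ψ`. -/
def dualClassOfRight (𝒳 : ObjectProperty (ModuleCat.{w} Rᵐᵒᵖ)) :
    ObjectProperty (ModuleCat.{w} R) :=
  fun M => ∀ φ ψ : PPFormula Rᵐᵒᵖ, PPFormula.LeOn 𝒳 φ ψ →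
    ψ.dualOfRight.ImpliesIn φ.dualOfRight M

end Duality

end RDMod

/-!
Characters turn annihilators into products. For a right ideal `I` of `R` and a left module `M`, the
characters of `M` killed by `I` are those that vanish on `I M`; for a right module `N`, the
characters of `N` vanishing on `{n | n I = 0}` are those in `I N*`, provided that `I` is finitely
generated. So `M*` is divisible if and only if `M` is torsion-free, and if all the right ideals
`𝔯(r)` are finitely generated, which is what P-coherence means, then `N*` is torsion-free if and
only if `N` is divisible, and torsion-freeness and divisibility are given by pp implications.

Conversely, each closure condition produces for every `r` a finitely generated right ideal
`J ≤ 𝔯(r)` that works for a generic element: the family of all elements of `𝔯(r)` in a product of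
copies of `R`, or the element of a direct limit of powers of `R*` represented by all characters
killed by a finite part of `𝔯(r)`. This forces `𝔯(r) = J`.

The duality between the two classes rests on the fact that a character `c` satisfies a pp formula
`φ` exactly when it vanishes on the solutions of `Dφ`. Hence a pp-axiomatizable class `𝒳` has as
its elementary dual the class of all modules `M` with `M*` in `𝒳`.
-/

namespace RDMod

section Characters

variable {A : Type*} [AddCommGroup A]

theorem exists_character_of_notMem (H : AddSubgroup A) {a : A} (ha : a ∉ H) :
    ∃ c : CharacterModule A, (∀ h ∈ H, c h = 0) ∧ c a ≠ 0 := by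
  have ha' : (a : A ⧸ H) ≠ 0 := mt (QuotientAddGroup.eq_zero_iff a).1 ha
  obtain ⟨d, hd⟩ := CharacterModule.exists_character_apply_ne_zero_of_ne_zero ha'
  refine ⟨AddMonoidHom.comp d (QuotientAddGroup.mk' H), fun h hh => ?_, hd⟩
  exact (congrArg d ((QuotientAddGroup.eq_zero_iff h).2 hh)).trans (map_zero d)

theorem exists_character_comp_eq {B : Type*} [AddCommGroup B] (g : A →+ B)
    (c : CharacterModule A) (hc : ∀ a, g a = 0 → c a = 0) :
    ∃ d : CharacterModule B, ∀ a, d (g a) = c a := by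
  let c' : CharacterModule (A ⧸ g.ker) := QuotientAddGroup.lift g.ker c fun a ha => hc a ha
  obtain ⟨d, hd⟩ := CharacterModule.dual_surjective_of_injective
    (QuotientAddGroup.kerLift g).toIntLinearMap (QuotientAddGroup.kerLift_injective g) c'
  exact ⟨d, fun a => DFunLike.congr_fun hd (a : A ⧸ g.ker)⟩

theorem exists_characters_sum_comp_eq {ι : Type*} [Fintype ι] {B : ι → Type*}
    [∀ i, AddCommGroup (B i)] (g : ∀ i, A →+ B i) (c : CharacterModule A)
    (hc : ∀ a, (∀ i, g i a = 0) → c a = 0) :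
    ∃ d : ∀ i, CharacterModule (B i), ∀ a, ∑ i, d i (g i a) = c a := by
  classical
  obtain ⟨d, hd⟩ := exists_character_comp_eq (AddMonoidHom.pi g) c fun a ha =>
    hc a fun i => congrFun ha i
  refine ⟨fun i => AddMonoidHom.comp d (AddMonoidHom.single B i), fun a => ?_⟩
  calc ∑ i, d (Pi.single i (g i a)) = d (∑ i, Pi.single i (g i a)) := (map_sum d _ _).symm
    _ = d (AddMonoidHom.pi g a) := by rw [Finset.univ_sum_single]; rfl
    _ = c a := hd a

/-- Evaluation of characters at `a`. -/
def characterEval (a : A) : CharacterModule A →+ AddCircle (1 : ℚ) :=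
  AddMonoidHom.eval a

theorem characterEval_apply (a : A) (c : CharacterModule A) : characterEval a c = c a := rfl

end Characters

section CharacterModules

variable (R : Type u) [Ring R]

/-- The right `R`-module structure on `Hom_ℤ(M, ℚ/ℤ)` for a left `R`-module `M`, given by
`(f r)(m) = f(r m)`. -/
@[reducible] def rightCharacterModuleStructure (M : Type w) [AddCommGroup M] [Module R M] :
    Module Rᵐᵒᵖ (CharacterModule M) :=
  inferInstanceAs (Module Rᵈᵐᵃ (M →+ AddCircle (1 : ℚ)))

attribute [local instance] characterModuleStructure rightCharacterModuleStructure

variable {R}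

theorem smul_character_apply {M : Type w} [AddCommGroup M] [Module Rᵐᵒᵖ M] (r : R)
    (c : CharacterModule M) (m : M) : (r • c) m = c (MulOpposite.op r • m) := rfl

theorem op_smul_character_apply {M : Type w} [AddCommGroup M] [Module R M] (r : Rᵐᵒᵖ)
    (c : CharacterModule M) (m : M) : (r • c) m = c (r.unop • m) := rfl

end CharacterModules

namespace PPFormula

section Solutions

variable {R : Type u} [Ring R] {M : Type w} [AddCommGroup M] [Module R M]
  {N : Type*} [AddCommGroup N] [Module R N]

/-- The subgroup `φ(M)` of solutions of a pp formula `φ` in a module `M`. -/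
def solutions (φ : PPFormula R) (M : Type w) [AddCommGroup M] [Module R M] : AddSubgroup M where
  carrier := {x | φ.Sat x}
  zero_mem' := ⟨0, fun j => by simp⟩
  add_mem' := by
    rintro x x' ⟨y, hy⟩ ⟨y', hy'⟩
    refine ⟨y + y', fun j => ?_⟩
    simp only [Pi.add_apply, smul_add, Finset.sum_add_distrib]
    rw [add_add_add_comm, hy, hy', add_zero]
  neg_mem' := by
    rintro x ⟨y, hy⟩
    refine ⟨-y, fun j => ?_⟩
    simp only [Pi.neg_apply, smul_neg, Finset.sum_neg_distrib]
    rw [← neg_add, hy, neg_zero]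

theorem Sat.map {φ : PPFormula R} {x : M} (hx : φ.Sat x) (f : M →ₗ[R] N) : φ.Sat (f x) := by
  obtain ⟨y, hy⟩ := hx
  exact ⟨fun i => f (y i), fun j => by simpa using congrArg f (hy j)⟩

theorem sat_pi_iff {ι : Type*} {M : ι → Type*} [∀ i, AddCommGroup (M i)] [∀ i, Module R (M i)]
    {φ : PPFormula R} {x : ∀ i, M i} : φ.Sat x ↔ ∀ i, φ.Sat (x i) := by
  refine ⟨fun hx i => hx.map (LinearMap.proj i), fun hx => ?_⟩
  choose y hy using hx
  exact ⟨fun l i => y i l, fun j => funext fun i => by simpa using hy i j⟩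

theorem Sat.of_isPure {φ : PPFormula R} {P : Submodule R M} (hP : IsPure P) {x : P}
    (hx : φ.Sat (x : M)) : φ.Sat x := by
  obtain ⟨y, hy⟩ := hx
  obtain ⟨t, ht⟩ := hP φ.k φ.n φ.B (fun j => -(φ.a j • x))
    ⟨y, fun j => by simpa [eq_neg_iff_add_eq_zero, add_comm] using hy j⟩
  exact ⟨t, fun j => by rw [ht, add_neg_cancel]⟩

theorem ImpliesIn.of_linearEquiv {φ ψ : PPFormula R} (h : φ.ImpliesIn ψ M) (e : M ≃ₗ[R] N) :
    φ.ImpliesIn ψ N := fun x hx => by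
  simpa using (h _ (hx.map e.symm.toLinearMap)).map e.toLinearMap

theorem ImpliesIn.pi {ι : Type*} {M : ι → Type*} [∀ i, AddCommGroup (M i)]
    [∀ i, Module R (M i)] {φ ψ : PPFormula R} (h : ∀ i, φ.ImpliesIn ψ (M i)) :
    φ.ImpliesIn ψ (∀ i, M i) := fun _ hx =>
  sat_pi_iff.2 fun i => h i _ (sat_pi_iff.1 hx i)

theorem ImpliesIn.of_isPure {φ ψ : PPFormula R} (h : φ.ImpliesIn ψ M) {P : Submodule R M}
    (hP : IsPure P) : φ.ImpliesIn ψ P := fun _ hx =>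
  (h _ (hx.map P.subtype)).of_isPure hP

end Solutions

section DirectLimit

variable {R : Type u} [Ring R] {ι : Type*} [Preorder ι] [IsDirectedOrder ι] [DecidableEq ι]
  {M : ι → Type*} [∀ i, AddCommGroup (M i)] [∀ i, Module R (M i)]
  {f : ∀ i j, i ≤ j → M i →ₗ[R] M j} [DirectedSystem M (fun i j h => f i j h)]

theorem sat_directLimit_of_iff {φ : PPFormula R} {i : ι} {x : M i} :
    φ.Sat (Module.DirectLimit.of R ι M f i x) ↔ ∃ j, ∃ hij : i ≤ j, φ.Sat (f i j hij x) := by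
  constructor
  · rintro ⟨y, hy⟩
    have : Nonempty ι := ⟨i⟩
    choose p t ht using fun l => Module.DirectLimit.exists_of (y l)
    obtain ⟨q₀, hq₀⟩ := Finite.exists_le p
    obtain ⟨q, hiq, hq⟩ := exists_ge_ge i q₀
    have hzero : ∀ j, Module.DirectLimit.of R ι M f q
        (φ.a j • f i q hiq x + ∑ l, φ.B j l • f (p l) q ((hq₀ l).trans hq) (t l)) = 0 := by
      intro j
      rw [← hy j]
      simp [Module.DirectLimit.of_f, ht]
    choose k hqk hk using fun j => Module.DirectLimit.of.zero_exact (hzero j)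
    obtain ⟨k₀, hk₀⟩ := Finite.exists_le k
    obtain ⟨m, hkm, hqm⟩ := exists_ge_ge k₀ q
    refine ⟨m, hiq.trans hqm, fun l => f q m hqm (f (p l) q ((hq₀ l).trans hq) (t l)),
      fun j => ?_⟩
    have := congrArg (f (k j) m ((hk₀ j).trans hkm)) (hk j)
    rw [map_zero, Module.DirectedSystem.map_map f] at this
    simpa [Module.DirectedSystem.map_map f] using this
  · rintro ⟨j, hij, hx⟩
    simpa only [Module.DirectLimit.of_f] using hx.map (Module.DirectLimit.of R ι M f j)

theorem ImpliesIn.directLimit [Nonempty ι] {φ ψ : PPFormula R}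
    (h : ∀ i, φ.ImpliesIn ψ (M i)) : φ.ImpliesIn ψ (Module.DirectLimit M f) := fun x hx => by
  obtain ⟨i, x, rfl⟩ := Module.DirectLimit.exists_of x
  obtain ⟨j, hij, hxj⟩ := sat_directLimit_of_iff.1 hx
  exact sat_directLimit_of_iff.2 ⟨j, hij, h j _ hxj⟩

end DirectLimit

section Examples

variable {R : Type u} [Ring R] {M : Type w} [AddCommGroup M] [Module R M]

/-- The annihilation formula `⋀ i, s i x = 0`. -/
def annihilated {n : ℕ} (s : Fin n → R) : PPFormula R where
  n := 0
  k := n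
  a := s
  B := fun _ => Fin.elim0

/-- The divisibility formula `∃ y, x = ∑ i, s i y i`, with the sign absorbed into the `y i`. -/
def combination {n : ℕ} (s : Fin n → R) : PPFormula R where
  n := n
  k := 1
  a := fun _ => 1
  B := fun _ => s

theorem sat_annihilated {n : ℕ} {s : Fin n → R} {x : M} :
    (annihilated s).Sat x ↔ ∀ i, s i • x = 0 := by
  simp [Sat, annihilated]

theorem sat_combination {n : ℕ} {s : Fin n → R} {x : M} :
    (combination s).Sat x ↔ ∃ y : Fin n → M, x = ∑ i, s i • y i := by
  have sat_iff : (combination s).Sat x ↔ ∃ y : Fin n → M, x + ∑ i, s i • y i = 0 :=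
    exists_congr fun y => Fin.forall_fin_one.trans <| by
      change (1 : R) • x + ∑ i, s i • y i = 0 ↔ _
      rw [one_smul]
  rw [sat_iff, ← (Equiv.neg (Fin n → M)).exists_congr_right]
  simp [← sub_eq_add_neg, sub_eq_zero]

theorem sat_combination_singleton {r : R} {x : M} :
    (combination fun _ : Fin 1 => r).Sat x ↔ ∃ y : M, x = r • y := by
  rw [sat_combination, (Equiv.funUnique (Fin 1) M).exists_congr_left]
  simp

end Examples

section Dual

variable {A B : Type u} [Ring A] {M : Type w} [AddCommGroup M] [Module A M]

/-- The elementary dual of a pp formula over `B` as a formula over `A`, with the coefficients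
transported along a map `e`. Both `PPFormula.dual` and `PPFormula.dualOfRight` are instances,
so the duality with characters need only be proved once. -/
def dualAlong (e : B → A) (φ : PPFormula B) : PPFormula A where
  n := φ.k
  k := φ.n + 1
  a := Fin.cons 1 (fun _ => 0)
  B := Fin.cons (fun j => e (φ.a j)) (fun i j => e (φ.B j i))

theorem sat_dualAlong {e : B → A} {φ : PPFormula B} {x : M} :
    (φ.dualAlong e).Sat x ↔ ∃ z : Fin φ.k → M,
      x + ∑ j, e (φ.a j) • z j = 0 ∧ ∀ i, ∑ j, e (φ.B j i) • z j = 0 :=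
  exists_congr fun z => Fin.forall_fin_succ.trans <| by
    change ((1 : A) • x + ∑ j, e (φ.a j) • z j = 0 ∧
      ∀ i, (0 : A) • x + ∑ j, e (φ.B j i) • z j = 0) ↔ _
    simp only [one_smul, zero_smul, zero_add]

theorem sat_dualAlong_combination [Ring B] {e : B → A} (he : e 1 = 1) {n : ℕ} {s : Fin n → B}
    {x : M} : ((combination s).dualAlong e).Sat x ↔ ∀ i, e (s i) • x = 0 := by
  have sat_iff : ((combination s).dualAlong e).Sat x ↔ ∃ z : Fin 1 → M,
      x + ∑ j, e 1 • z j = 0 ∧ ∀ i, ∑ j, e (s i) • z j = 0 := sat_dualAlong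
  rw [sat_iff, (Equiv.funUnique (Fin 1) M).exists_congr_left]
  simp [he, add_eq_zero_iff_eq_neg']

variable [Ring B] [Module B (CharacterModule M)] {e : B → A}
  (smul_apply : ∀ (b : B) (c : CharacterModule M) (m : M), (b • c) m = c (e b • m))

include smul_apply

theorem Sat.character_apply_eq_zero {φ : PPFormula B} {c : CharacterModule M} (hc : φ.Sat c)
    {x : M} (hx : (φ.dualAlong e).Sat x) : c x = 0 := by
  obtain ⟨y, hy⟩ := hc
  obtain ⟨z, hz, hz'⟩ := sat_dualAlong.1 hx
  have eval_eqn : ∀ j, c (e (φ.a j) • z j) + ∑ i, y i (e (φ.B j i) • z j) = 0 := fun j => by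
    have := congrArg (characterEval (z j)) (hy j)
    simpa only [map_add, map_sum, map_zero, characterEval_apply, smul_apply] using this
  have eval_bound_vars : ∑ j, ∑ i, y i (e (φ.B j i) • z j) = 0 := by
    rw [Finset.sum_comm]
    exact Finset.sum_eq_zero fun i _ => by rw [← map_sum, hz', map_zero]
  calc c x = c x + ∑ j, (c (e (φ.a j) • z j) + ∑ i, y i (e (φ.B j i) • z j)) := by
        simp [eval_eqn]
    _ = c (x + ∑ j, e (φ.a j) • z j) := by
        rw [Finset.sum_add_distrib, eval_bound_vars, add_zero, map_add, map_sum]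
    _ = 0 := by rw [hz, map_zero]

theorem sat_character_of_forall {φ : PPFormula B} {c : CharacterModule M}
    (hc : ∀ x : M, (φ.dualAlong e).Sat x → c x = 0) : φ.Sat c := by
  -- Solving the equations means factoring `z ↦ c (∑ j, a j • z j)` through
  -- `z ↦ (∑ j, B j i • z j)ᵢ`, and `ℚ/ℤ` is injective.
  let pair (v : Fin φ.k → A) : (Fin φ.k → M) →+ M :=
    AddMonoidHom.mk' (fun z => ∑ j, v j • z j) fun z z' => by
      simp only [Pi.add_apply, smul_add, Finset.sum_add_distrib]
  obtain ⟨d, hd⟩ : ∃ d : Fin φ.n → CharacterModule M, ∀ z : Fin φ.k → M,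
      ∑ i, d i (∑ j, e (φ.B j i) • z j) = c (∑ j, e (φ.a j) • z j) := by
    refine exists_characters_sum_comp_eq (fun i => pair fun j => e (φ.B j i))
      (AddMonoidHom.comp c (pair fun j => e (φ.a j))) fun z hz => ?_
    exact neg_eq_zero.1 <| (map_neg c _).symm.trans <| hc _ <|
      sat_dualAlong.2 ⟨z, neg_add_cancel _, hz⟩
  refine ⟨-d, fun j => CharacterModule.ext M fun m => ?_⟩
  have hdj : ∑ i, d i (e (φ.B j i) • m) = c (e (φ.a j) • m) := by
    simpa [Pi.single_apply] using hd (Pi.single j m)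
  calc characterEval m (φ.a j • c + ∑ i, φ.B j i • (-d) i)
      = c (e (φ.a j) • m) + ∑ i, (-d) i (e (φ.B j i) • m) := by
        simp only [map_add, map_sum, characterEval_apply, smul_apply]
    _ = c (e (φ.a j) • m) + -∑ i, d i (e (φ.B j i) • m) := by
        rw [← Finset.sum_neg_distrib]; rfl
    _ = 0 := by rw [hdj, add_neg_cancel]

theorem sat_character_iff {φ : PPFormula B} {c : CharacterModule M} :
    φ.Sat c ↔ ∀ x : M, (φ.dualAlong e).Sat x → c x = 0 :=
  ⟨fun hc _ hx => hc.character_apply_eq_zero smul_apply hx, sat_character_of_forall smul_apply⟩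

theorem impliesIn_character_iff {φ ψ : PPFormula B} :
    φ.ImpliesIn ψ (CharacterModule M) ↔ (ψ.dualAlong e).ImpliesIn (φ.dualAlong e) M := by
  constructor
  · intro h x hx
    by_contra hx'
    obtain ⟨c, hc, hcx⟩ := exists_character_of_notMem ((φ.dualAlong e).solutions M) hx'
    exact hcx ((sat_character_iff smul_apply).1 (h c ((sat_character_iff smul_apply).2 hc)) x hx)
  · intro h c hc
    rw [sat_character_iff smul_apply] at hc ⊢
    exact fun x hx => hc x (h x hx)

end Dual

end PPFormula

theorem IsPPAxiomatizable.isDefinable {R : Type u} [Ring R] {𝒳 : ObjectProperty (ModuleCat.{w} R)}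
    (h : IsPPAxiomatizable 𝒳) : IsDefinable 𝒳 := by
  obtain ⟨S, hS⟩ := h
  exact
    { iso := ⟨fun e hM => (hS _).2 fun σ hσ =>
        ((hS _).1 hM σ hσ).of_linearEquiv e.toLinearEquiv⟩
      products := fun ι M hM => (hS _).2 fun σ hσ => .pi fun i => (hS _).1 (hM i) σ hσ
      directLimits := fun ι _ _ _ _ M f _ hM => (hS _).2 fun σ hσ =>
        .directLimit fun i => (hS _).1 (hM i) σ hσ
      pureSubmodules := fun M N hN hM => (hS _).2 fun σ hσ => ((hS _).1 hM σ hσ).of_isPure hN }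

section DualClass

variable {R : Type u} [Ring R]

attribute [local instance] characterModuleStructure rightCharacterModuleStructure

theorem PPFormula.impliesIn_characterModule_iff {M : Type w} [AddCommGroup M] [Module Rᵐᵒᵖ M]
    {φ ψ : PPFormula R} :
    φ.ImpliesIn ψ (CharacterModule M) ↔ ψ.dual.ImpliesIn φ.dual M :=
  impliesIn_character_iff (e := MulOpposite.op) smul_character_apply

theorem PPFormula.impliesIn_rightCharacterModule_iff {M : Type w} [AddCommGroup M] [Module R M]
    {φ ψ : PPFormula Rᵐᵒᵖ} :
    φ.ImpliesIn ψ (CharacterModule M) ↔ ψ.dualOfRight.ImpliesIn φ.dualOfRight M :=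
  impliesIn_character_iff (e := MulOpposite.unop) op_smul_character_apply

/-- The character module `M* = Hom_ℤ(M, ℚ/ℤ)` of a left `R`-module, a right `R`-module. -/
def rightCharacterModule (M : ModuleCat.{w} R) : ModuleCat.{w} Rᵐᵒᵖ :=
  ModuleCat.of Rᵐᵒᵖ (CharacterModule M)

theorem IsPPAxiomatizable.dualClass_iff {𝒳 : ObjectProperty (ModuleCat.{w} R)}
    (h : IsPPAxiomatizable 𝒳) {M : ModuleCat.{w} Rᵐᵒᵖ} :
    dualClass 𝒳 M ↔ 𝒳 (characterModule R M) := by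
  obtain ⟨S, hS⟩ := h
  refine ⟨fun hM => (hS _).2 fun σ hσ => ?_, fun hM φ ψ hφψ => ?_⟩
  · exact PPFormula.impliesIn_characterModule_iff.2 (hM _ _ fun N hN => (hS N).1 hN σ hσ)
  · exact PPFormula.impliesIn_characterModule_iff.1 (hφψ _ hM)

theorem IsPPAxiomatizable.dualClassOfRight_iff {𝒳 : ObjectProperty (ModuleCat.{w} Rᵐᵒᵖ)}
    (h : IsPPAxiomatizable 𝒳) {M : ModuleCat.{w} R} :
    dualClassOfRight 𝒳 M ↔ 𝒳 (rightCharacterModule M) := by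
  obtain ⟨S, hS⟩ := h
  refine ⟨fun hM => (hS _).2 fun σ hσ => ?_, fun hM φ ψ hφψ => ?_⟩
  · exact PPFormula.impliesIn_rightCharacterModule_iff.2 (hM _ _ fun N hN => (hS N).1 hN σ hσ)
  · exact PPFormula.impliesIn_rightCharacterModule_iff.1 (hφψ _ hM)

end DualClass

section RightAnnihilator

variable {R : Type u} [Ring R]

/-- The right annihilator `𝔯(r)`, as a right ideal. -/
def rightAnnihilator (r : R) : Submodule Rᵐᵒᵖ R :=
  LinearMap.ker (DistribSMul.toLinearMap Rᵐᵒᵖ R r)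

theorem isRightPCoherent_iff_fg_rightAnnihilator :
    IsRightPCoherent R ↔ ∀ r : R, (rightAnnihilator r).FG := by
  have self_finitePresentation : Module.FinitePresentation Rᵐᵒᵖ R :=
    .of_equiv (MulOpposite.opLinearEquiv Rᵐᵒᵖ).symm
  refine forall_congr' fun r => ?_
  let mul_r := DistribSMul.toLinearMap Rᵐᵒᵖ R r
  have span_eq_range : Submodule.span Rᵐᵒᵖ {r} = LinearMap.range mul_r := by
    ext x
    rw [Submodule.mem_span_singleton, LinearMap.mem_range]
    exact MulOpposite.opEquiv.symm.exists_congr_left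
  rw [span_eq_range, ← Module.FinitePresentation.fg_ker_iff _ mul_r.surjective_rangeRestrict,
    LinearMap.ker_rangeRestrict, rightAnnihilator]

end RightAnnihilator

section IdealSMul

variable {R : Type u} [Ring R] {I J : Submodule Rᵐᵒᵖ R} {M : Type*} [AddCommGroup M] [Module R M]
  {N : Type*} [AddCommGroup N] [Module R N]

/-- The subgroup `I M` of finite sums of products `s n` with `s ∈ I` and `n ∈ M`, for a right
ideal `I` and a left module `M`. -/
def idealSMul (I : Submodule Rᵐᵒᵖ R) (M : Type*) [AddCommGroup M] [Module R M] : AddSubgroup M :=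
  AddSubgroup.closure {x | ∃ (s : R) (n : M), s ∈ I ∧ x = s • n}

theorem smul_mem_idealSMul {s : R} (hs : s ∈ I) (n : M) : s • n ∈ idealSMul I M :=
  AddSubgroup.subset_closure ⟨s, n, hs, rfl⟩

theorem idealSMul_le_iff {H : AddSubgroup M} : idealSMul I M ≤ H ↔ ∀ s ∈ I, ∀ n : M, s • n ∈ H := by
  rw [idealSMul, AddSubgroup.closure_le]
  exact ⟨fun h s hs n => h ⟨s, n, hs, rfl⟩, fun h _ ⟨s, n, hs, hx⟩ => hx ▸ h s hs n⟩

theorem idealSMul_mono (h : I ≤ J) : idealSMul I M ≤ idealSMul J M :=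
  idealSMul_le_iff.2 fun _ hs n => smul_mem_idealSMul (h hs) n

theorem idealSMul_self_le : idealSMul I R ≤ I.toAddSubgroup :=
  idealSMul_le_iff.2 fun _ hs t => I.smul_mem (MulOpposite.op t) hs

theorem map_mem_idealSMul (f : M →ₗ[R] N) {x : M} (hx : x ∈ idealSMul I M) :
    f x ∈ idealSMul I N := by
  suffices idealSMul I M ≤ (idealSMul I N).comap f.toAddMonoidHom from this hx
  refine idealSMul_le_iff.2 fun s hs n => ?_
  simpa using smul_mem_idealSMul hs (f n)

theorem mem_span_range_iff_exists_sum {n : ℕ} {s : Fin n → R} {t : R} :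
    t ∈ Submodule.span Rᵐᵒᵖ (Set.range s) ↔ ∃ u : Fin n → R, t = ∑ i, s i * u i := by
  rw [Submodule.mem_span_range_iff_exists_fun,
    (Equiv.piCongrRight fun _ : Fin n => MulOpposite.opEquiv (α := R)).symm.exists_congr_left]
  simp [eq_comm]

theorem mem_idealSMul_span_range_iff {n : ℕ} {s : Fin n → R} {x : M} :
    x ∈ idealSMul (Submodule.span Rᵐᵒᵖ (Set.range s)) M ↔ (PPFormula.combination s).Sat x := by
  constructor
  · suffices idealSMul (Submodule.span Rᵐᵒᵖ (Set.range s)) M ≤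
      (PPFormula.combination s).solutions M from fun hx => this hx
    refine idealSMul_le_iff.2 fun t ht m => PPFormula.sat_combination.2 ?_
    obtain ⟨u, rfl⟩ := mem_span_range_iff_exists_sum.1 ht
    exact ⟨fun i => u i • m, by simp only [Finset.sum_smul, mul_smul]⟩
  · intro hx
    obtain ⟨y, rfl⟩ := PPFormula.sat_combination.1 hx
    exact sum_mem fun i _ => smul_mem_idealSMul (Submodule.subset_span (Set.mem_range_self i)) (y i)

theorem exists_fg_le_of_mem_idealSMul {x : M} (hx : x ∈ idealSMul I M) :
    ∃ J ≤ I, J.FG ∧ x ∈ idealSMul J M := by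
  induction hx using AddSubgroup.closure_induction with
  | mem x hx =>
    obtain ⟨s, n, hs, rfl⟩ := hx
    exact ⟨Submodule.span Rᵐᵒᵖ {s}, (Submodule.span_singleton_le_iff_mem s I).2 hs,
      Submodule.fg_span_singleton s, smul_mem_idealSMul (Submodule.mem_span_singleton_self s) n⟩
  | zero => exact ⟨⊥, bot_le, Submodule.fg_bot, zero_mem _⟩
  | add x y _ _ hx hy =>
    obtain ⟨J, hJI, hJ, hxJ⟩ := hx
    obtain ⟨K, hKI, hK, hyK⟩ := hy
    exact ⟨J ⊔ K, sup_le hJI hKI, hJ.sup hK,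
      add_mem (idealSMul_mono le_sup_left hxJ) (idealSMul_mono le_sup_right hyK)⟩
  | neg x _ hx =>
    obtain ⟨J, hJI, hJ, hxJ⟩ := hx
    exact ⟨J, hJI, hJ, neg_mem hxJ⟩

theorem mem_idealSMul_pi_iff (hI : I.FG) {ι : Type*} {M : ι → Type*} [∀ i, AddCommGroup (M i)]
    [∀ i, Module R (M i)] {x : ∀ i, M i} :
    x ∈ idealSMul I (∀ i, M i) ↔ ∀ i, x i ∈ idealSMul I (M i) := by
  obtain ⟨n, s, rfl⟩ := Submodule.fg_iff_exists_fin_generating_family.1 hI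
  simp only [mem_idealSMul_span_range_iff, PPFormula.sat_pi_iff]

theorem sat_annihilated_op_iff {P : Type*} [AddCommGroup P] [Module Rᵐᵒᵖ P] {n : ℕ}
    {s : Fin n → R} {m : P} : (PPFormula.annihilated fun i => MulOpposite.op (s i)).Sat m ↔
      ∀ t ∈ Submodule.span Rᵐᵒᵖ (Set.range s), MulOpposite.op t • m = 0 := by
  rw [PPFormula.sat_annihilated]
  refine ⟨fun h t ht => ?_, fun h i => h _ (Submodule.subset_span (Set.mem_range_self i))⟩
  obtain ⟨u, rfl⟩ := mem_span_range_iff_exists_sum.1 ht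
  simp [Finset.sum_smul, mul_smul, h]

end IdealSMul

section CharacterDuality

variable {R : Type u} [Ring R] {I : Submodule Rᵐᵒᵖ R}

attribute [local instance] characterModuleStructure rightCharacterModuleStructure

theorem mem_idealSMul_iff_forall_character {M : Type w} [AddCommGroup M] [Module R M] {x : M} :
    x ∈ idealSMul I M ↔
      ∀ c : CharacterModule M, (∀ s ∈ I, MulOpposite.op s • c = 0) → c x = 0 := by
  constructor
  · intro hx c hc
    let c' : M →+ AddCircle (1 : ℚ) := c
    suffices idealSMul I M ≤ c'.ker from this hx
    exact idealSMul_le_iff.2 fun s hs n => DFunLike.congr_fun (hc s hs) n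
  · intro h
    by_contra hx
    obtain ⟨c, hc, hcx⟩ := exists_character_of_notMem _ hx
    exact hcx <| h c fun s hs => CharacterModule.ext M fun n => hc _ (smul_mem_idealSMul hs n)

theorem mem_idealSMul_character_iff (hI : I.FG) {M : Type w} [AddCommGroup M] [Module Rᵐᵒᵖ M]
    {f : CharacterModule M} : f ∈ idealSMul I (CharacterModule M) ↔
      ∀ m : M, (∀ s ∈ I, MulOpposite.op s • m = 0) → f m = 0 := by
  obtain ⟨n, s, rfl⟩ := Submodule.fg_iff_exists_fin_generating_family.1 hI
  rw [mem_idealSMul_span_range_iff, PPFormula.sat_character_iff (e := MulOpposite.op)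
    smul_character_apply]
  simp only [PPFormula.sat_dualAlong_combination (e := MulOpposite.op (α := R)) rfl,
    ← sat_annihilated_op_iff, PPFormula.sat_annihilated]

theorem exists_eq_op_smul_character_iff {M : Type w} [AddCommGroup M] [Module R M] {r : R}
    {c : CharacterModule M} :
    (∃ d : CharacterModule M, c = MulOpposite.op r • d) ↔ ∀ m : M, r • m = 0 → c m = 0 := by
  constructor
  · rintro ⟨d, rfl⟩ m hm
    rw [op_smul_character_apply, MulOpposite.unop_op, hm, map_zero]
  · intro hc
    obtain ⟨d, hd⟩ := exists_character_comp_eq (DistribSMul.toAddMonoidHom M r) c hc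
    exact ⟨d, CharacterModule.ext M fun m => (hd m).symm⟩

theorem isDivisible_character_iff {M : Type w} [AddCommGroup M] [Module R M] :
    IsDivisible R (CharacterModule M) ↔ IsTorsionFree R M := by
  refine forall_congr' fun r => ?_
  have mem_iff {m : M} := mem_idealSMul_iff_forall_character (I := rightAnnihilator r) (x := m)
  exact ⟨fun h m hm => mem_iff.2 fun c hc => exists_eq_op_smul_character_iff.1 (h c hc) m hm,
    fun h c hc => exists_eq_op_smul_character_iff.2 fun m hm => mem_iff.1 (h m hm) c hc⟩

theorem IsRightPCoherent.isTorsionFree_character_iff (h : IsRightPCoherent R) {M : Type w}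
    [AddCommGroup M] [Module Rᵐᵒᵖ M] :
    IsTorsionFree R (CharacterModule M) ↔ IsDivisible R M := by
  refine forall_congr' fun r => ?_
  have mem_iff {f : CharacterModule M} := mem_idealSMul_character_iff (f := f)
    (isRightPCoherent_iff_fg_rightAnnihilator.1 h r)
  constructor
  · intro h m hm
    by_contra hmr
    obtain ⟨f, hf, hfm⟩ := exists_character_of_notMem
      (DistribSMul.toAddMonoidHom M (MulOpposite.op r)).range
      fun ⟨n, hn⟩ => hmr ⟨n, hn.symm⟩
    exact hfm <| mem_iff.1 (h f <| CharacterModule.ext M fun n => hf _ ⟨n, rfl⟩) m hm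
  · intro h f hf
    refine mem_iff.2 fun m hm => ?_
    obtain ⟨n, rfl⟩ := h m hm
    exact DFunLike.congr_fun hf n

end CharacterDuality

section PPAxioms

variable {R : Type u} [Ring R]

theorem IsRightPCoherent.isPPAxiomatizable_tf (h : IsRightPCoherent R) :
    IsPPAxiomatizable (Tf.{u, w} R) := by
  choose n s hs using fun r => Submodule.fg_iff_exists_fin_generating_family.1
    (isRightPCoherent_iff_fg_rightAnnihilator.1 h r)
  refine ⟨Set.range fun r => (.annihilated fun _ : Fin 1 => r, .combination (s r)), fun M => ?_⟩
  rw [Set.forall_mem_range]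
  refine forall_congr' fun r => forall_congr' fun m => ?_
  rw [PPFormula.sat_annihilated, ← mem_idealSMul_span_range_iff, hs, forall_const (Fin 1)]
  rfl

theorem IsRightPCoherent.isPPAxiomatizable_div (h : IsRightPCoherent R) :
    IsPPAxiomatizable (Div.{u, w} R) := by
  choose n s hs using fun r => Submodule.fg_iff_exists_fin_generating_family.1
    (isRightPCoherent_iff_fg_rightAnnihilator.1 h r)
  refine ⟨Set.range fun r => (.annihilated fun i => MulOpposite.op (s r i),
    .combination fun _ : Fin 1 => MulOpposite.op r), fun M => ?_⟩
  rw [Set.forall_mem_range]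
  refine forall_congr' fun r => forall_congr' fun m => ?_
  rw [sat_annihilated_op_iff, hs, PPFormula.sat_combination_singleton]
  rfl

theorem IsRightPCoherent.dualClassOfRight_div (h : IsRightPCoherent R) :
    dualClassOfRight (Div.{u, w} R) = Tf.{u, w} R := by
  ext M
  exact h.isPPAxiomatizable_div.dualClassOfRight_iff.trans isDivisible_character_iff

theorem IsRightPCoherent.dualClass_tf (h : IsRightPCoherent R) :
    dualClass (Tf.{u, w} R) = Div.{u, w} R := by
  ext M
  exact h.isPPAxiomatizable_tf.dualClass_iff.trans h.isTorsionFree_character_iff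

end PPAxioms

section Converse

variable {R : Type u} [Ring R]

attribute [local instance] characterModuleStructure rightCharacterModuleStructure

theorem isTorsionFree_ulift : IsTorsionFree R (ULift.{v} R) := by
  intro r t ht
  have : t = t.down • ULift.up 1 := ULift.ext _ _ (mul_one _).symm
  rw [this]
  exact smul_mem_idealSMul (I := rightAnnihilator r) (congrArg ULift.down ht) _

theorem IsRightPCoherent.of_closedUnderProducts
    (h : ClosedUnderProducts (Tf.{u, max u v} R)) : IsRightPCoherent R := by
  refine isRightPCoherent_iff_fg_rightAnnihilator.2 fun r => ?_
  let ι := ULift.{v} (rightAnnihilator r)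
  let generic : ι → ULift.{max u v} R := fun s => ⟨s.down⟩
  have isTorsionFree_pi : IsTorsionFree R (ι → ULift.{max u v} R) :=
    h ι (fun _ => ModuleCat.of R (ULift.{max u v} R)) fun _ => isTorsionFree_ulift
  obtain ⟨J, hJr, hJ, mem_J⟩ := exists_fg_le_of_mem_idealSMul (I := rightAnnihilator r) <|
    isTorsionFree_pi r generic (funext fun s => ULift.ext _ _ s.down.2)
  suffices rightAnnihilator r ≤ J from hJr.antisymm this ▸ hJ
  exact fun s hs => idealSMul_self_le <|
    map_mem_idealSMul (ULift.moduleEquiv.toLinearMap ∘ₗ LinearMap.proj ⟨s, hs⟩) mem_J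

theorem IsDivisible.pi {ι : Type*} {M : ι → Type*} [∀ i, AddCommGroup (M i)]
    [∀ i, Module Rᵐᵒᵖ (M i)] (h : ∀ i, IsDivisible R (M i)) : IsDivisible R (∀ i, M i) := by
  intro r m hm
  choose n hn using fun i => h i r (m i) fun s hs => congrFun (hm s hs) i
  exact ⟨n, funext hn⟩

theorem IsDivisible.dfinsupp {ι : Type*} {M : ι → Type*} [∀ i, AddCommGroup (M i)]
    [∀ i, Module Rᵐᵒᵖ (M i)] (h : ∀ i, IsDivisible R (M i)) : IsDivisible R (Π₀ i, M i) := by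
  classical
  intro r m hm
  choose n hn using fun i => h i r (m i) fun s hs => DFunLike.congr_fun (hm s hs) i
  refine ⟨DFinsupp.mk m.support fun i => n i, DFinsupp.ext fun i => ?_⟩
  rw [DFinsupp.smul_apply, DFinsupp.mk_apply]
  split_ifs with hi
  · exact hn i
  · rw [smul_zero, ← DFinsupp.notMem_support_iff]
    exact hi

theorem closedUnderProducts_tf_of_isTorsionFree_character
    (h : ∀ M : ModuleCat.{w} Rᵐᵒᵖ, IsDivisible R M → IsTorsionFree R (characterModule R M)) :
    ClosedUnderProducts (Tf.{u, w} R) := by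
  classical
  intro ι M hM r x hx
  -- `f` is `x` seen as a character of the direct sum of the character modules. That a single `J`
  -- works for `f` makes it work in all coordinates at once.
  let N := Π₀ i, CharacterModule (M i)
  let f : CharacterModule N := DFinsupp.liftAddHom fun i => characterEval (x i)
  have f_single (i) (c : CharacterModule (M i)) : f (DFinsupp.single i c) = c (x i) :=
    DFinsupp.liftAddHom_apply_single (fun i => characterEval (x i)) i c
  have smul_f : r • f = 0 := by
    refine DFinsupp.addHom_ext (f := r • f) (g := 0) fun i c => ?_
    change f (MulOpposite.op r • DFinsupp.single i c) = 0
    rw [← DFinsupp.single_smul, f_single, op_smul_character_apply]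
    exact (congrArg c (congrFun hx i)).trans (map_zero c)
  obtain ⟨J, hJr, hJ, f_mem⟩ := exists_fg_le_of_mem_idealSMul (I := rightAnnihilator r) <|
    h (.of Rᵐᵒᵖ N) (.dfinsupp fun i => isDivisible_character_iff.2 (hM i)) r f smul_f
  refine idealSMul_mono hJr <| (mem_idealSMul_pi_iff hJ).2 fun i =>
    mem_idealSMul_iff_forall_character.2 fun c hc => ?_
  rw [← f_single]
  refine (mem_idealSMul_character_iff hJ).1 f_mem _ fun s hs => ?_
  rw [← DFinsupp.single_smul, hc s hs, DFinsupp.single_zero]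

theorem exists_fg_le_rightAnnihilator_of_closedUnderDirectLimits
    (h : ClosedUnderDirectLimits (Div.{u, max u v} R)) {M : Type max u v} [AddCommGroup M]
    [Module Rᵐᵒᵖ M] (hM : IsDivisible R M) (r : R) :
    ∃ J ≤ rightAnnihilator r, J.FG ∧
      ∀ m : M, (∀ s ∈ J, MulOpposite.op s • m = 0) → ∃ n, m = MulOpposite.op r • n := by
  classical
  -- The inclusions `x F` of the subsets `X F` into `M` have a common image in the direct limit of
  -- the powers `X F → M`; its divisibility by `r` holds already at one stage, and there for all
  -- elements of `X F` simultaneously.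
  let ι := Finset (ULift.{v} (rightAnnihilator r))
  let X (F : ι) : Type max u v := {m : M // ∀ s ∈ F, MulOpposite.op (s.down : R) • m = 0}
  let P (F : ι) : ModuleCat.{max u v} Rᵐᵒᵖ := .of Rᵐᵒᵖ (X F → M)
  let f (F G : ι) (hFG : F ≤ G) : P F →ₗ[Rᵐᵒᵖ] P G :=
    LinearMap.funLeft Rᵐᵒᵖ M fun m => ⟨m.1, fun s hs => m.2 s (hFG hs)⟩
  have : DirectedSystem (fun F => P F) (fun F G hFG => f F G hFG) :=
    ⟨fun _ _ => rfl, fun _ _ _ _ _ _ => rfl⟩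
  let x (F : ι) : P F := Subtype.val
  let ξ (F : ι) := Module.DirectLimit.of Rᵐᵒᵖ ι (fun F => P F) f F (x F)
  have ξ_eq (F : ι) : ξ ∅ = ξ F :=
    (Module.DirectLimit.of_f (f := f) (hij := Finset.empty_subset F) (x := x ∅)).symm
  obtain ⟨η, hη⟩ := h ι P f (fun F => .pi fun _ => hM) r (ξ ∅) fun s hs => by
    have smul_x : MulOpposite.op s • x {⟨s, hs⟩} = 0 :=
      funext fun m => m.2 _ (Finset.mem_singleton_self _)
    rw [ξ_eq {⟨s, hs⟩}, ← map_smul, smul_x, map_zero]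
  obtain ⟨G, _, sat_G⟩ :=
    PPFormula.sat_directLimit_of_iff.1 (PPFormula.sat_combination_singleton.2 ⟨η, hη⟩)
  obtain ⟨y, hy⟩ : ∃ y, x G = MulOpposite.op r • y := PPFormula.sat_combination_singleton.1 sat_G
  refine ⟨Submodule.span Rᵐᵒᵖ (G.image fun s => (s.down : R)), ?_,
    Submodule.fg_span (Finset.finite_toSet _), fun m hm => ?_⟩
  · refine Submodule.span_le.2 fun s hs => ?_
    obtain ⟨t, -, rfl⟩ := Finset.mem_image.1 hs
    exact t.down.2
  · exact ⟨_, congrFun hy ⟨m, fun s hs => hm _ <|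
      Submodule.subset_span (Finset.mem_image_of_mem _ hs)⟩⟩

theorem IsRightPCoherent.of_closedUnderDirectLimits
    (h : ClosedUnderDirectLimits (Div.{u, max u v} R)) : IsRightPCoherent R := by
  refine isRightPCoherent_iff_fg_rightAnnihilator.2 fun r => ?_
  obtain ⟨J, hJr, hJ, exists_eq_smul⟩ := exists_fg_le_rightAnnihilator_of_closedUnderDirectLimits h
    (isDivisible_character_iff.2 (isTorsionFree_ulift (R := R))) r
  suffices rightAnnihilator r ≤ J from hJr.antisymm this ▸ hJ
  intro s hs
  have mem_J : ULift.up.{v} s ∈ idealSMul J (ULift.{v} R) :=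
    mem_idealSMul_iff_forall_character.2 fun c hc =>
      exists_eq_op_smul_character_iff.1 (exists_eq_smul c hc) _ (congrArg ULift.up hs)
  exact idealSMul_self_le (map_mem_idealSMul ULift.moduleEquiv.toLinearMap mem_J)

end Converse

end RDMod

theorem mainTheorem3 (R : Type u) [Ring R] :
    List.TFAE [
      RDMod.IsRightPCoherent R,
      RDMod.ClosedUnderProducts (RDMod.Tf.{u, max u v} R),
      RDMod.ClosedUnderDirectLimits (RDMod.Div.{u, max u v} R),
      ∀ M : ModuleCat.{max u v} Rᵐᵒᵖ,
        RDMod.IsDivisible R M ↔ RDMod.IsTorsionFree R (RDMod.characterModule R M),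
      RDMod.IsDefinable (RDMod.Tf.{u, max u v} R),
      RDMod.IsPPAxiomatizable (RDMod.Tf.{u, max u v} R),
      RDMod.IsDefinable (RDMod.Div.{u, max u v} R),
      RDMod.IsPPAxiomatizable (RDMod.Div.{u, max u v} R)] ∧
    (RDMod.IsRightPCoherent R →
      RDMod.dualClassOfRight (RDMod.Div.{u, max u v} R) = RDMod.Tf.{u, max u v} R ∧
      RDMod.dualClass (RDMod.Tf.{u, max u v} R) = RDMod.Div.{u, max u v} R) := by
  refine ⟨?_, fun h => ⟨h.dualClassOfRight_div, h.dualClass_tf⟩⟩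
  tfae_have 1 → 6 := fun h => h.isPPAxiomatizable_tf
  tfae_have 6 → 5 := fun h => h.isDefinable
  tfae_have 5 → 2 := fun h => h.products
  tfae_have 2 → 1 := RDMod.IsRightPCoherent.of_closedUnderProducts
  tfae_have 1 → 8 := fun h => h.isPPAxiomatizable_div
  tfae_have 8 → 7 := fun h => h.isDefinable
  tfae_have 7 → 3 := fun h => h.directLimits
  tfae_have 3 → 1 := RDMod.IsRightPCoherent.of_closedUnderDirectLimits
  tfae_have 1 → 4 := fun h _ => h.isTorsionFree_character_iff.symm
  tfae_have 4 → 2 := fun h =>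
    RDMod.closedUnderProducts_tf_of_isTorsionFree_character fun M => (h M).1
  tfae_finish
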